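/- A $C^\infty$-ring is a set $A$ together with, for every $n\in\mathbb N$ and every $C^\infty$ function $f:\mathbb R^n\to\mathbb R$, an operation $f^A:A^n\to A$ such that projections are interpreted as projections and every identity $f=h\circ(g_1,\dots,g_n)$ between smooth functions is respected: $f^A=h^A\circ(g_1^A,\dots,g_n^A)$. It is a commutative ring under the interpretations of $0$, $1$, $x+y$, $-x$ and $xy$. A $C^\infty$-homomorphism is a map commuting with all these operations. For $S\subseteq A$, the $C^\infty$-ring of fractions $A\{S^{-1}\}$ is a $C^\infty$-ring with a $C^\infty$-homomorphism $\eta_S:A\to A\{S^{-1}\}$ that sends every element of $S$ to an invertible element and is universal with this property. The $C^\infty$-radical of an ideal $I$ of $A$ is $\sqrt[\infty]{I}=\{a\in A : (A/I)\{(a+I)^{-1}\}\cong 0\}$, and $A$ is called $C^\infty$-reduced if $\sqrt[\infty]{(0)}=(0)$. The canonical relation $\prec$ on $A$ is defined by $$a\prec b\iff \text{there is an invertible } u\in A \text{ with } b-a=u^2 .$$ **Theorem.** Let $A$ be a $C^\infty$-reduced $C^\infty$-ring that is non-trivial (that is, $0\neq 1$ in $A$). Then $\prec$ is irreflexive, transitive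 and asymmetric, so it is a strict partial order on $A$. Moreover it is compatible with the sum and with the product: for all $a,b,x\in A$, 1. if $a\prec b$, then $a+x\prec b+x$; 2. if $a\prec b$ and $0\prec x$, then $a\cdot x\prec b\cdot x$. -/

import Mathlib

open scoped ContDiff

universe u

/-- `C^∞(ℝⁿ, ℝ)`, the set of `n`-ary function symbols of the language of `C^∞`-rings. -/
def SmoothFun (n : ℕ) : Type :=
  {f : (Fin n → ℝ) → ℝ // ContDiff ℝ ∞ f}

namespace SmoothFun

/-- The projection `p_k : ℝⁿ → ℝ`. -/
def proj {n : ℕ} (k : Fin n) : SmoothFun n :=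
  ⟨fun x => x k, contDiff_apply ℝ ℝ k⟩

/-- The constant functions. -/
def const (n : ℕ) (r : ℝ) : SmoothFun n :=
  ⟨fun _ => r, contDiff_const⟩

/-- The pointwise sum. -/
def add {n : ℕ} (f g : SmoothFun n) : SmoothFun n :=
  ⟨fun x => f.1 x + g.1 x, f.2.add g.2⟩

/-- The pointwise product. -/
def mul {n : ℕ} (f g : SmoothFun n) : SmoothFun n :=
  ⟨fun x => f.1 x * g.1 x, f.2.mul g.2⟩

/-- The pointwise negative. -/
def neg {n : ℕ} (f : SmoothFun n) : SmoothFun n :=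
  ⟨fun x => -f.1 x, f.2.neg⟩

end SmoothFun

/-- A `C^∞`-ring (in sets): a set with an interpretation of every smooth function `ℝⁿ → ℝ` as an
`n`-ary operation, preserving the projections and all compositions of smooth functions. -/
structure CInftyRing : Type (u + 1) where
  /-- the underlying set -/
  carrier : Type u
  /-- the interpretation `Φ(f) : Aⁿ → A` of a smooth function -/
  op : ∀ {n : ℕ}, SmoothFun n → (Fin n → carrier) → carrier
  op_proj : ∀ {n : ℕ} (k : Fin n) (x : Fin n → carrier), op (SmoothFun.proj k) x = x k
  op_comp : ∀ {m n : ℕ} (f : SmoothFun m) (g : Fin n → SmoothFun m) (h : SmoothFun n),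
    (∀ t : Fin m → ℝ, f.1 t = h.1 (fun i => (g i).1 t)) →
    ∀ x : Fin m → carrier, op f x = op h (fun i => op (g i) x)

namespace CInftyRing

instance : CoeSort CInftyRing.{u} (Type u) := ⟨CInftyRing.carrier⟩

variable (A : CInftyRing.{u})

/-! The ring operations are the interpretations of the smooth functions `0`, `1`, `x + y`, `x * y`
and `-x`. -/

instance : Zero A := ⟨A.op (SmoothFun.const 0 0) ![]⟩
instance : One A := ⟨A.op (SmoothFun.const 0 1) ![]⟩
instance : Add A := ⟨fun a b => A.op (SmoothFun.add (.proj 0) (.proj 1)) ![a, b]⟩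
instance : Mul A := ⟨fun a b => A.op (SmoothFun.mul (.proj 0) (.proj 1)) ![a, b]⟩
instance : Neg A := ⟨fun a => A.op (SmoothFun.neg (.proj 0)) ![a]⟩

theorem op_const_zero {n : ℕ} (x : Fin n → A) : A.op (SmoothFun.const n 0) x = 0 := by
  rw [A.op_comp (SmoothFun.const n 0) ![] (SmoothFun.const 0 0) (fun _ => rfl) x]
  exact congrArg _ (Subsingleton.elim _ _)

theorem op_const_one {n : ℕ} (x : Fin n → A) : A.op (SmoothFun.const n 1) x = 1 := by
  rw [A.op_comp (SmoothFun.const n 1) ![] (SmoothFun.const 0 1) (fun _ => rfl) x]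
  exact congrArg _ (Subsingleton.elim _ _)

theorem op_add {n : ℕ} (f g : SmoothFun n) (x : Fin n → A) :
    A.op (f.add g) x = A.op f x + A.op g x := by
  rw [A.op_comp (f.add g) ![f, g] (SmoothFun.add (.proj 0) (.proj 1)) (fun _ => rfl) x]
  refine congrArg _ (funext fun i => ?_)
  fin_cases i <;> rfl

theorem op_mul {n : ℕ} (f g : SmoothFun n) (x : Fin n → A) :
    A.op (f.mul g) x = A.op f x * A.op g x := by
  rw [A.op_comp (f.mul g) ![f, g] (SmoothFun.mul (.proj 0) (.proj 1)) (fun _ => rfl) x]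
  refine congrArg _ (funext fun i => ?_)
  fin_cases i <;> rfl

theorem op_neg {n : ℕ} (f : SmoothFun n) (x : Fin n → A) :
    A.op f.neg x = -A.op f x := by
  rw [A.op_comp f.neg ![f] (SmoothFun.neg (.proj 0)) (fun _ => rfl) x]
  refine congrArg _ (funext fun i => ?_)
  fin_cases i; rfl

/-- Equal smooth functions have the same interpretation in every `C^∞`-ring. -/
theorem op_congr {n : ℕ} {f g : SmoothFun n} (h : ∀ t, f.1 t = g.1 t) (x : Fin n → A) :
    A.op f x = A.op g x :=
  congrArg (fun s => A.op s x) (Subtype.ext (funext h))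

/-- The underlying commutative ring of a `C^∞`-ring. -/
instance : CommRing A where
  add_assoc a b c := by
    have h := A.op_congr (f := ((SmoothFun.proj 0).add (.proj 1)).add (.proj 2))
      (g := (SmoothFun.proj 0).add ((SmoothFun.proj 1).add (.proj 2)))
      (fun t => add_assoc (t 0) (t 1) (t 2)) ![a, b, c]
    simp only [op_add, op_proj] at h
    exact h
  add_comm a b := by
    have h := A.op_congr (f := (SmoothFun.proj 0).add (.proj 1))
      (g := (SmoothFun.proj 1).add (.proj 0))
      (fun t => add_comm (t 0) (t 1)) ![a, b]
    simp only [op_add, op_proj] at h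
    exact h
  zero_add a := by
    have h := A.op_congr (f := (SmoothFun.const 1 0).add (.proj 0)) (g := .proj 0)
      (fun t => zero_add (t 0)) ![a]
    simp only [op_add, op_proj, op_const_zero] at h
    exact h
  add_zero a := by
    have h := A.op_congr (f := (SmoothFun.proj 0).add (.const 1 0)) (g := .proj 0)
      (fun t => add_zero (t 0)) ![a]
    simp only [op_add, op_proj, op_const_zero] at h
    exact h
  neg_add_cancel a := by
    have h := A.op_congr (f := (SmoothFun.neg (.proj 0)).add (.proj 0)) (g := .const 1 0)
      (fun t => neg_add_cancel (t 0)) ![a]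
    simp only [op_add, op_proj, op_neg, op_const_zero] at h
    exact h
  mul_assoc a b c := by
    have h := A.op_congr (f := ((SmoothFun.proj 0).mul (.proj 1)).mul (.proj 2))
      (g := (SmoothFun.proj 0).mul ((SmoothFun.proj 1).mul (.proj 2)))
      (fun t => mul_assoc (t 0) (t 1) (t 2)) ![a, b, c]
    simp only [op_mul, op_proj] at h
    exact h
  mul_comm a b := by
    have h := A.op_congr (f := (SmoothFun.proj 0).mul (.proj 1))
      (g := (SmoothFun.proj 1).mul (.proj 0))
      (fun t => mul_comm (t 0) (t 1)) ![a, b]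
    simp only [op_mul, op_proj] at h
    exact h
  one_mul a := by
    have h := A.op_congr (f := (SmoothFun.const 1 1).mul (.proj 0)) (g := .proj 0)
      (fun t => one_mul (t 0)) ![a]
    simp only [op_mul, op_proj, op_const_one] at h
    exact h
  mul_one a := by
    have h := A.op_congr (f := (SmoothFun.proj 0).mul (.const 1 1)) (g := .proj 0)
      (fun t => mul_one (t 0)) ![a]
    simp only [op_mul, op_proj, op_const_one] at h
    exact h
  zero_mul a := by
    have h := A.op_congr (f := (SmoothFun.const 1 0).mul (.proj 0)) (g := .const 1 0)
      (fun t => zero_mul (t 0)) ![a]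
    simp only [op_mul, op_proj, op_const_zero] at h
    exact h
  mul_zero a := by
    have h := A.op_congr (f := (SmoothFun.proj 0).mul (.const 1 0)) (g := .const 1 0)
      (fun t => mul_zero (t 0)) ![a]
    simp only [op_mul, op_proj, op_const_zero] at h
    exact h
  left_distrib a b c := by
    have h := A.op_congr (f := (SmoothFun.proj 0).mul ((SmoothFun.proj 1).add (.proj 2)))
      (g := ((SmoothFun.proj 0).mul (.proj 1)).add ((SmoothFun.proj 0).mul (.proj 2)))
      (fun t => mul_add (t 0) (t 1) (t 2)) ![a, b, c]
    simp only [op_mul, op_add, op_proj] at h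
    exact h
  right_distrib a b c := by
    have h := A.op_congr (f := ((SmoothFun.proj 0).add (.proj 1)).mul (.proj 2))
      (g := ((SmoothFun.proj 0).mul (.proj 2)).add ((SmoothFun.proj 1).mul (.proj 2)))
      (fun t => add_mul (t 0) (t 1) (t 2)) ![a, b, c]
    simp only [op_mul, op_add, op_proj] at h
    exact h
  nsmul := nsmulRec
  zsmul := zsmulRec

end CInftyRing

/-- `C^∞`-homomorphisms. -/
structure CInftyHom (A B : CInftyRing.{u}) where
  /-- the underlying map -/
  toFun : A → B
  map_op : ∀ {n : ℕ} (f : SmoothFun n) (x : Fin n → A),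
    toFun (A.op f x) = B.op f (fun i => toFun (x i))

instance (A B : CInftyRing.{u}) : CoeFun (CInftyHom A B) (fun _ => A → B) := ⟨CInftyHom.toFun⟩

namespace CInftyRing

variable {A : CInftyRing.{u}}

/-- `η : A → F` is a `C^∞`-ring of fractions `A{S⁻¹}` of `A` with respect to `S`: it inverts the
elements of `S` and is universal among the `C^∞`-homomorphisms that do so. -/
structure IsRingOfFractions (S : Set A) {F : CInftyRing.{u}} (η : CInftyHom A F) : Prop where
  isUnit : ∀ s ∈ S, IsUnit (η s)
  existsUnique_lift : ∀ (B : CInftyRing.{u}) (φ : CInftyHom A B), (∀ s ∈ S, IsUnit (φ s)) →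
    ∃! ψ : CInftyHom F B, ∀ a : A, ψ (η a) = φ a

/-- `q : A → Q` is a quotient `A → A / I` in `C^∞`-rings: a surjective `C^∞`-homomorphism with
kernel `I`. -/
structure IsQuotient (I : Ideal A) {Q : CInftyRing.{u}} (q : CInftyHom A Q) : Prop where
  surjective : Function.Surjective q
  ker : ∀ a : A, q a = 0 ↔ a ∈ I

/-- The `C^∞`-radical `{a ∈ A | (A / I){(a + I)⁻¹} ≅ 0}` of an ideal `I`. The quotient and the ring
of fractions are determined up to isomorphism, so it does not matter which ones are taken. -/
def smoothRadical (I : Ideal A) : Set A :=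
  {a | ∃ (Q : CInftyRing.{u}) (q : CInftyHom A Q) (F : CInftyRing.{u}) (η : CInftyHom Q F),
    IsQuotient I q ∧ IsRingOfFractions {q a} η ∧ Subsingleton F}

variable (A) in
/-- `A` is `C^∞`-reduced if the `C^∞`-radical of `(0)` is `(0)`. -/
def IsSmoothReduced : Prop :=
  smoothRadical (⊥ : Ideal A) = ((⊥ : Ideal A) : Set A)

/-- The canonical relation: `a ≺ b` iff `b - a` is the square of an invertible element. -/
def prec (a b : A) : Prop :=
  ∃ v : A, IsUnit v ∧ b - a = v ^ 2

end CInftyRing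

namespace SmoothFun

/-! Everything rests on closing the squares of units under addition. Since `1 + t²` is bounded away
from `0`, both its square root and the reciprocal of that root are smooth on all of `ℝ`. Their
identities pass to any `C^∞`-ring, making `1 + c²` the square of a unit; scaling by a unit gives
`exists_isUnit_sq_eq_sq_add_sq`, hence transitivity. Irreflexivity says that `0` is not a unit, and
asymmetry follows from these two. -/

/-- The smooth function `t ↦ √(1 + t²)`. -/
noncomputable def sqrtOneAddSq : SmoothFun 1 :=
  ⟨fun t => √(1 + t 0 ^ 2),
    (contDiff_const.add ((contDiff_apply ℝ ℝ 0).pow 2)).sqrt fun t => by positivity⟩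

/-- The smooth function `t ↦ 1 / √(1 + t²)`. -/
noncomputable def invSqrtOneAddSq : SmoothFun 1 :=
  ⟨fun t => (√(1 + t 0 ^ 2))⁻¹, sqrtOneAddSq.2.inv fun t => by
    change √(1 + t 0 ^ 2) ≠ 0
    positivity⟩

end SmoothFun

namespace CInftyRing

variable {A : CInftyRing.{u}}

/-- In a `C^∞`-ring, `1 + c²` is the square of an invertible element. -/
theorem exists_isUnit_sq_eq_one_add_sq (c : A) : ∃ s : A, IsUnit s ∧ s ^ 2 = 1 + c ^ 2 := by
  refine ⟨A.op SmoothFun.sqrtOneAddSq ![c],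
    IsUnit.of_mul_eq_one (A.op SmoothFun.invSqrtOneAddSq ![c]) ?_, ?_⟩
  -- Both sides become interpretations of smooth functions, so invertibility reduces to a pointwise
  -- identity over `ℝ`.
  · rw [← op_mul, ← op_const_one A ![c]]
    refine op_congr A (fun t => mul_inv_cancel₀ (a := √(1 + t 0 ^ 2)) ?_) _
    positivity
  · have h := A.op_congr (f := SmoothFun.sqrtOneAddSq.mul .sqrtOneAddSq)
      (g := (SmoothFun.const 1 1).add ((SmoothFun.proj 0).mul (.proj 0)))
      (fun t => (Real.mul_self_sqrt (by positivity)).trans (by rw [sq]; rfl)) ![c]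
    simp only [op_mul, op_add, op_proj, op_const_one] at h
    rw [sq, sq, h]
    rfl

/-- In a `C^∞`-ring, a sum of two squares `u² + v²` with `u` invertible is the square of an
invertible element: `u² + v² = (u √(1 + (v / u)²))²`. -/
theorem exists_isUnit_sq_eq_sq_add_sq {u : A} (hu : IsUnit u) (v : A) :
    ∃ w : A, IsUnit w ∧ w ^ 2 = u ^ 2 + v ^ 2 := by
  obtain ⟨u', huu'⟩ := hu.exists_right_inv
  obtain ⟨s, hs, hsq⟩ := exists_isUnit_sq_eq_one_add_sq (v * u')
  refine ⟨u * s, hu.mul hs, ?_⟩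
  -- The second coefficient comes from `(u * u') ^ 2 - 1 = (u * u' + 1) * (u * u' - 1)`.
  linear_combination u ^ 2 * hsq + v ^ 2 * (u * u' + 1) * huu'

theorem not_prec_self [Nontrivial A] (a : A) : ¬ prec a a := by
  rintro ⟨v, hv, h⟩
  rw [sub_self] at h
  exact not_isUnit_zero (h ▸ hv.pow 2)

/-- The difference `c - a = (b - a) + (c - b)` is a sum of two squares of units. -/
theorem prec.trans {a b c : A} : prec a b → prec b c → prec a c := by
  rintro ⟨u, hu, hab⟩ ⟨v, -, hbc⟩
  obtain ⟨w, hw, h⟩ := exists_isUnit_sq_eq_sq_add_sq hu v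
  exact ⟨w, hw, by linear_combination hab + hbc - h⟩

theorem prec.add_right {a b : A} (x : A) : prec a b → prec (a + x) (b + x) := by
  rintro ⟨u, hu, hab⟩
  exact ⟨u, hu, by linear_combination hab⟩

/-- Squares of units are closed under products, and `b * x - a * x = (b - a) * x`. -/
theorem prec.mul_right {a b x : A} : prec a b → prec 0 x → prec (a * x) (b * x) := by
  rintro ⟨u, hu, hab⟩ ⟨v, hv, hx⟩
  exact ⟨u * v, hu.mul hv, by linear_combination x * hab + u ^ 2 * hx⟩

end CInftyRing

/-- The canonical relation on a non-trivial `C^∞`-reduced `C^∞`-ring is a strict partial order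
compatible with sum and product. -/
theorem theorem3p12 (A : CInftyRing.{u}) (hnt : Nontrivial A) (hred : A.IsSmoothReduced) :
    (∀ a : A, ¬ CInftyRing.prec a a) ∧
    (∀ a b c : A, CInftyRing.prec a b → CInftyRing.prec b c → CInftyRing.prec a c) ∧
    (∀ a b : A, CInftyRing.prec a b → ¬ CInftyRing.prec b a) ∧
    IsStrictOrder A CInftyRing.prec ∧
    (∀ a b x : A, CInftyRing.prec a b → CInftyRing.prec (a + x) (b + x)) ∧
    (∀ a b x : A, CInftyRing.prec a b → CInftyRing.prec 0 x →
      CInftyRing.prec (a * x) (b * x)) := by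
  exact ⟨CInftyRing.not_prec_self, fun _ _ _ => .trans,
    fun a _ hab hba => CInftyRing.not_prec_self a (hab.trans hba),
    { irrefl := CInftyRing.not_prec_self, trans := fun _ _ _ => .trans },
    fun _ _ x hab => hab.add_right x, fun _ _ _ hab hx => hab.mul_right hx⟩
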